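/- **Theorem 6.2.** Let $H$ be a complex Hilbert space, $m\ge 2$, and let $P_1,\dots,P_m$ be orthogonal projections on $H$. Let $R_0\in B(H)$ be positive and trace class. For finite words over $\mathcal A=\{1,\dots,m\}$ put $R_\emptyset=R_0$ and $$R_{wj}=R_w^{1/2}(I-P_j)R_w^{1/2},\qquad D_{wj}=R_w^{1/2}P_jR_w^{1/2}.$$ Assume the leakage condition: there is $\alpha>0$ with $\sum_{j=1}^m\langle v,P_jv\rangle\ge\alpha\|v\|^2$ for all $v\in H_0:=\overline{\mathrm{ran}}(R_0^{1/2})$. Let $x\in H$ satisfy $\langle x,R_0x\rangle>0$, and let $q=(q_1,\dots,q_m)$ be an arbitrary probability vector. Put $a_{wj}=\langle x,D_{wj}x\rangle$, and let $p_x(j\mid w)=a_{wj}/\sum_{k}a_{wk}$ if $\sum_k a_{wk}>0$ and $p_x(j\mid w)=q_j$ otherwise. Let $\nu_x$ be the unique Borel probability measure on $\Omega=\mathcal A^{\mathbb N}$ such that $$\nu_x([j_1\cdots j_n])=p_x(j_1\mid\emptyset)\,p_x(j_2\mid j_1)\cdots p_x(j_n\mid j_1\cdots j_{n-1})$$ for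 every cylinder $[j_1\cdots j_n]$, $n\ge 0$. For $\omega=(j_1,j_2,\dots)\in\Omega$ and $k\ge1$ let $\Delta_k(\omega)=D_{j_1\cdots j_k}$ and $A_k(\omega)=\langle x,\Delta_k(\omega)x\rangle$. Then every $\Delta_k(\omega)$ has a spectral decomposition $\Delta_k(\omega)=\sum_{r\in\mathcal R_k(\omega)}\lambda_{k,r}(\omega)\,|u_{k,r}(\omega)\rangle\langle u_{k,r}(\omega)|$, converging in the strong operator topology, with a countable index set $\mathcal R_k(\omega)$, an orthonormal family $(u_{k,r}(\omega))_r$ and $\lambda_{k,r}(\omega)\ge0$. Moreover there is a measurable set $\Omega_x\subset\Omega$ with $\nu_x(\Omega_x)=1$ such that, for every $\omega\in\Omega_x$ and every choice of such decompositions (over index sets of any cardinality), the atoms $\varphi_{k,r}(\omega)=\lambda_{k,r}(\omega)^{1/2}u_{k,r}(\omega)$ satisfy $$\langle x,R_0x\rangle=\sum_{k=1}^\infty A_k(\omega)=\sum_{k=1}^\infty\ \sum_{r\in\mathcal R_k(\omega)}|\langle x,\varphi_{k,r}(\omega)\rangle|^2,$$ where $A_k(\omega)=\sum_{r}|\langle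 x,\varphi_{k,r}(\omega)\rangle|^2\ge 0$ for each $k$, and the double series of nonnegative terms converges to $\langle x,R_0x\rangle$ both as an iterated sum and unconditionally over all pairs $(k,r)$. -/

import Mathlib

open MeasureTheory ProbabilityTheory

namespace WR

noncomputable section

section Operators

variable {H : Type*} [NormedAddCommGroup H] [InnerProductSpace ℂ H] [CompleteSpace H]

/-- The quadratic form `⟨x, T x⟩` (its real part; for a positive `T` it is real already). -/
def energy (T : H →L[ℂ] H) (x : H) : ℝ := (inner ℂ x (T x)).re

/-- `T` is trace class: `∑ᵢ ⟨bᵢ, |T| bᵢ⟩ < ∞` for an orthonormal basis `b`, where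
`|T| = (T* T)^{1/2}`. (The sum does not depend on the basis, and every Hilbert space has one.) -/
def IsTraceClass {H : Type*} [NormedAddCommGroup H] [InnerProductSpace ℂ H] [CompleteSpace H]
    (T : H →L[ℂ] H) : Prop :=
  ∃ (s : Set H) (b : HilbertBasis s ℂ H), Summable fun i => energy (CFC.abs T) (b i)

/-- The dissipated piece `R^{1/2} P R^{1/2}`. -/
def dissipation (P R : H →L[ℂ] H) : H →L[ℂ] H := CFC.sqrt R * P * CFC.sqrt R

/-- The weighted residual map `Φ_P(R) = R^{1/2} (I - P) R^{1/2}`. -/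
def residualMap (P R : H →L[ℂ] H) : H →L[ℂ] H := CFC.sqrt R * (1 - P) * CFC.sqrt R

variable {m : ℕ}

/-- The residual operator `R_w` at a finite word `w = j₁ … jₙ`:
`R_∅ = R₀` and `R_{wj} = Φ_{P_j}(R_w)`. -/
def residual (P : Fin m → H →L[ℂ] H) (R₀ : H →L[ℂ] H) (w : List (Fin m)) : H →L[ℂ] H :=
  w.foldl (fun R j => residualMap (P j) R) R₀

/-- The dissipated piece `D_{wj} = R_w^{1/2} P_j R_w^{1/2}`. -/
def dissipated (P : Fin m → H →L[ℂ] H) (R₀ : H →L[ℂ] H) (w : List (Fin m)) (j : Fin m) :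
    H →L[ℂ] H :=
  dissipation (P j) (residual P R₀ w)

/-- A branch `(j₁, j₂, …)` is coded as `ω : ℕ → Fin m` with `ω k = j_{k+1}`;
this is its prefix `ω|n = j₁ … jₙ`. -/
def pre (ω : ℕ → Fin m) (n : ℕ) : List (Fin m) := List.ofFn fun i : Fin n => ω i

/-- The dissipated operator along `ω` at step `k + 1`: `Δ_{k+1}(ω) = D_{ω|k, j_{k+1}}`.
So the steps `1, 2, 3, …` are numbered by `k = 0, 1, 2, …`. -/
def branchDissipated (P : Fin m → H →L[ℂ] H) (R₀ : H →L[ℂ] H) (ω : ℕ → Fin m) (k : ℕ) :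
    H →L[ℂ] H :=
  dissipated P R₀ (pre ω k) (ω k)

/-- The scalar dissipated energy `A_{k+1}(ω) = ⟨x, Δ_{k+1}(ω) x⟩`. -/
def branchEnergy (P : Fin m → H →L[ℂ] H) (R₀ : H →L[ℂ] H) (x : H) (ω : ℕ → Fin m) (k : ℕ) : ℝ :=
  energy (branchDissipated P R₀ ω k) x

/-- The closed subspace `H₀ = closure (ran R₀^{1/2})`. -/
def support (R₀ : H →L[ℂ] H) : Submodule ℂ H :=
  (LinearMap.range (CFC.sqrt R₀ : H →L[ℂ] H).toLinearMap).topologicalClosure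

/-- The leakage condition: for some `α > 0`, `∑ⱼ Pⱼ ≥ α I` on `H₀`
(as quadratic forms on `H₀`). -/
def Leakage (P : Fin m → H →L[ℂ] H) (R₀ : H →L[ℂ] H) : Prop :=
  ∃ α : ℝ, 0 < α ∧ ∀ v ∈ support R₀, α * ‖v‖ ^ 2 ≤ energy (∑ j, P j) v

/-- The energy-biased transition probability `p_x(j | w)`, namely `a_{wj} / ∑ₖ a_{wk}` with
`a_{wj} = ⟨x, D_{wj} x⟩` if the node `w` is alive (`∑ₖ a_{wk} > 0`), and the reference value `q_j`
if it is dead. -/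
def transProb (P : Fin m → H →L[ℂ] H) (R₀ : H →L[ℂ] H) (x : H) (q : stdSimplex ℝ (Fin m))
    (w : List (Fin m)) (j : Fin m) : ℝ :=
  open Classical in
  if 0 < ∑ k, energy (dissipated P R₀ w k) x then
    energy (dissipated P R₀ w j) x / ∑ k, energy (dissipated P R₀ w k) x
  else q j

lemma energy_dissipation_nonneg {P : H →L[ℂ] H} (hP : IsStarProjection P) (R : H →L[ℂ] H)
    (x : H) : 0 ≤ energy (dissipation P R) x := by
  have hs : (CFC.sqrt R).IsPositive := by
    rw [← ContinuousLinearMap.nonneg_iff_isPositive]; exact CFC.sqrt_nonneg R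
  have hp : P.IsPositive := by
    rw [← ContinuousLinearMap.nonneg_iff_isPositive]; exact hP.nonneg
  have h : inner ℂ x (dissipation P R x) = inner ℂ (CFC.sqrt R x) (P (CFC.sqrt R x)) := by
    have := hs.isSelfAdjoint.isSymmetric x (P (CFC.sqrt R x))
    simpa [dissipation] using this.symm
  rw [energy, h]
  exact hp.re_inner_nonneg_right _

lemma transProb_nonneg {P : Fin m → H →L[ℂ] H} (hP : ∀ j, IsStarProjection (P j))
    (R₀ : H →L[ℂ] H) (x : H) (q : stdSimplex ℝ (Fin m)) (w : List (Fin m)) (j : Fin m) :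
    0 ≤ transProb P R₀ x q w j := by
  unfold transProb
  split_ifs with h
  · exact div_nonneg (energy_dissipation_nonneg (hP j) _ x) h.le
  · exact q.2.1 j

lemma sum_transProb (P : Fin m → H →L[ℂ] H) (R₀ : H →L[ℂ] H) (x : H)
    (q : stdSimplex ℝ (Fin m)) (w : List (Fin m)) : ∑ j, transProb P R₀ x q w j = 1 := by
  unfold transProb
  split_ifs with h
  · rw [← Finset.sum_div, div_self h.ne']
  · exact q.2.2

/-- The probability distribution `p_x(· | w)` on the alphabet. -/
def transPMF (P : Fin m → H →L[ℂ] H) (hP : ∀ j, IsStarProjection (P j)) (R₀ : H →L[ℂ] H) (x : H)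
    (q : stdSimplex ℝ (Fin m)) (w : List (Fin m)) : PMF (Fin m) :=
  PMF.ofFintype (fun j => ENNReal.ofReal (transProb P R₀ x q w j)) (by
    rw [← ENNReal.ofReal_sum_of_nonneg fun j _ => transProb_nonneg hP R₀ x q w j,
      sum_transProb, ENNReal.ofReal_one])

/-- The transition kernel of the branching: given the letters `j₁, …, j_{n+1}` (numbered
`0, …, n`), the next letter has law `p_x(· | j₁ … j_{n+1})`. -/
def stepKernel (P : Fin m → H →L[ℂ] H) (hP : ∀ j, IsStarProjection (P j)) (R₀ : H →L[ℂ] H) (x : H)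
    (q : stdSimplex ℝ (Fin m)) (n : ℕ) :
    Kernel ((i : Finset.Iic n) → (fun _ : ℕ => Fin m) i) ((fun _ : ℕ => Fin m) (n + 1)) where
  toFun u := (transPMF P hP R₀ x q (List.ofFn fun i : Fin (n + 1) =>
    u ⟨i, Finset.mem_Iic.2 (Nat.lt_succ_iff.1 i.2)⟩)).toMeasure
  measurable' := measurable_of_finite _

instance (P : Fin m → H →L[ℂ] H) (hP : ∀ j, IsStarProjection (P j)) (R₀ : H →L[ℂ] H) (x : H)
    (q : stdSimplex ℝ (Fin m)) (n : ℕ) : IsMarkovKernel (stepKernel P hP R₀ x q n) :=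
  ⟨fun _ => PMF.toMeasure.isProbabilityMeasure _⟩

/-- The energy-biased path measure `ν_x` on the space of branches: the first letter has law
`p_x(· | ∅)` and then the letters follow the transition kernels. It is the Borel probability
measure with `ν_x([j₁ … jₙ]) = p_x(j₁ | ∅) p_x(j₂ | j₁) ⋯ p_x(jₙ | j₁ … jₙ₋₁)`, see
`pathMeasure_cylinder`. -/
def pathMeasure (P : Fin m → H →L[ℂ] H) (hP : ∀ j, IsStarProjection (P j)) (R₀ : H →L[ℂ] H) (x : H)
    (q : stdSimplex ℝ (Fin m)) : Measure (ℕ → Fin m) :=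
  Kernel.trajMeasure (X := fun _ => Fin m) (transPMF P hP R₀ x q []).toMeasure
    (stepKernel P hP R₀ x q)

instance (P : Fin m → H →L[ℂ] H) (hP : ∀ j, IsStarProjection (P j)) (R₀ : H →L[ℂ] H) (x : H)
    (q : stdSimplex ℝ (Fin m)) : IsProbabilityMeasure (pathMeasure P hP R₀ x q) := by
  unfold pathMeasure; infer_instance

/-- The cylinder formula, for the cylinder of all branches that share the first `n` letters
with a given branch. -/
theorem pathMeasure_cylinder (P : Fin m → H →L[ℂ] H) (hP : ∀ j, IsStarProjection (P j))
    (R₀ : H →L[ℂ] H) (x : H) (q : stdSimplex ℝ (Fin m)) (η : ℕ → Fin m) (n : ℕ) :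
    pathMeasure P hP R₀ x q {ω | ∀ i < n, ω i = η i} =
      ∏ k ∈ Finset.range n, ENNReal.ofReal (transProb P R₀ x q (pre η k) (η k)) := by
  induction n with
  | zero => simp
  | succ n ih =>
    rw [Finset.prod_range_succ, ← ih]
    cases n with
    | zero =>
      have h0 : (pathMeasure P hP R₀ x q).map (fun ω => ω 0) =
          (transPMF P hP R₀ x q []).toMeasure := by
        unfold pathMeasure Kernel.trajMeasure
        rw [Measure.map_comp _ _ (by fun_prop)]
        have : (fun ω : ℕ → Fin m => ω 0) =
            (fun u : (i : Finset.Iic 0) → (fun _ : ℕ => Fin m) i => u ⟨0, by simp⟩) ∘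
              Preorder.frestrictLe 0 := rfl
        rw [this, Kernel.map_comp_right _ (by fun_prop) (by fun_prop),
          Kernel.traj_map_frestrictLe, Kernel.partialTraj_self, ← Measure.map_comp _ _ (by fun_prop),
          Measure.id_comp, Measure.map_map (by fun_prop) (by fun_prop)]
        exact Measure.map_id
      have h1 : {ω : ℕ → Fin m | ∀ i < 0 + 1, ω i = η i} = (fun ω => ω 0) ⁻¹' {η 0} := by
        ext ω; simp
      rw [h1, ← Measure.map_apply (by fun_prop) (measurableSet_singleton _), h0,
        PMF.toMeasure_apply_singleton _ _ (measurableSet_singleton _)]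
      simp [transPMF, pre]
    | succ a =>
      have hk := Kernel.map_frestrictLe_trajMeasure_compProd_eq_map_trajMeasure
        (X := fun _ : ℕ => Fin m) (μ₀ := (transPMF P hP R₀ x q []).toMeasure)
        (κ := stepKernel P hP R₀ x q) (a := a)
      change (pathMeasure P hP R₀ x q).map _ ⊗ₘ _ = (pathMeasure P hP R₀ x q).map _ at hk
      have h1 : {ω : ℕ → Fin m | ∀ i < a + 1 + 1, ω i = η i} =
          (fun ω : ℕ → Fin m => ((Preorder.frestrictLe a ω : (i : Finset.Iic a) → Fin m),
            ω (a + 1))) ⁻¹' ({Preorder.frestrictLe a η} ×ˢ {η (a + 1)}) := by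
        ext ω
        simp only [Set.mem_ofPred_eq, Set.mem_preimage, Set.mem_prod, Set.mem_singleton_iff,
          funext_iff, Preorder.frestrictLe_apply]
        constructor
        · intro h
          exact ⟨fun i => h i (by have := Finset.mem_Iic.1 i.2; omega), h _ (by omega)⟩
        · rintro ⟨h, h'⟩ i hi
          rcases Nat.lt_succ_iff_lt_or_eq.1 hi with hi | rfl
          · exact h ⟨i, Finset.mem_Iic.2 (by omega)⟩
          · exact h'
      have h2 : {ω : ℕ → Fin m | ∀ i < a + 1, ω i = η i} =
          (Preorder.frestrictLe (π := fun _ : ℕ => Fin m) a) ⁻¹' {Preorder.frestrictLe a η} := by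
        ext ω
        simp only [Set.mem_ofPred_eq, Set.mem_preimage, Set.mem_singleton_iff,
          funext_iff, Preorder.frestrictLe_apply]
        constructor
        · intro h i
          exact h i (by have := Finset.mem_Iic.1 i.2; omega)
        · intro h i hi
          exact h ⟨i, Finset.mem_Iic.2 (by omega)⟩
      rw [h1, ← Measure.map_apply (by fun_prop) (by measurability)]
      erw [← hk]
      rw [Measure.compProd_apply_prod (measurableSet_singleton _) (measurableSet_singleton _),
        lintegral_singleton, h2, ← Measure.map_apply (by fun_prop) (measurableSet_singleton _),
        mul_comm]
      congr 1
      change (transPMF P hP R₀ x q _).toMeasure _ = _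
      rw [PMF.toMeasure_apply_singleton _ _ (measurableSet_singleton _)]
      simp [transPMF, pre, Preorder.frestrictLe_apply]

/-- A spectral decomposition `T = ∑ᵣ λᵣ |uᵣ⟩⟨uᵣ|` (convergence in the strong operator topology)
with an orthonormal family `u` and nonnegative eigenvalues `λ`. -/
structure SpectralSystem (T : H →L[ℂ] H) (ι : Type*) where
  u : ι → H
  ev : ι → ℝ
  orthonormal : Orthonormal ℂ u
  ev_nonneg : ∀ r, 0 ≤ ev r
  hasSum : ∀ y : H, HasSum (fun r => ((ev r : ℂ) * inner ℂ (u r) y) • u r) (T y)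

/-- The atoms `φᵣ = λᵣ^{1/2} uᵣ` of a spectral decomposition. -/
def SpectralSystem.atom {T : H →L[ℂ] H} {ι : Type*} (S : SpectralSystem T ι) (r : ι) : H :=
  ((Real.sqrt (S.ev r) : ℝ) : ℂ) • S.u r

end Operators

end

end WR

open Filter Topology
open scoped ComplexOrder

universe u

namespace WR

/-! ### Quadratic forms of operators. -/

section Energy

variable {H : Type*} [NormedAddCommGroup H] [InnerProductSpace ℂ H]

/-! Since `R = R^{1/2} R^{1/2}`, each step splits `R_w` exactly into `R_{wj} + D_{wj}`. Along a
branch the energies `A_k` therefore telescope, and their sum is `⟨x, R₀ x⟩` once the residual energy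
tends to `0`.

That limit comes from the bias of the measure. Let a node have residual energy `s` and dissipated
energies `a_j`. Choosing `j` with probability `a_j / ∑ a` loses `∑ a_j² / ∑ a ≥ (∑ a) / m ≥ (α / m)
s` on average, by Cauchy–Schwarz and leakage (`sum_transProb_mul_energy_le`). Leakage is available
at every node because `R_w ≤ R₀` puts the range of `R_w^{1/2}` inside `H₀`
(`sqrt_apply_mem_support`). The expected residual energies thus decay geometrically; their sum has
finite expectation, so it is finite almost surely and its terms tend to `0`.

The spectral part is deterministic: `D_{wj} ≤ R₀` has summable diagonal, hence is compact with
countably many nonzero eigenvalues. Pairing any spectral expansion of `Δ_k` with `x` writes `A_k` as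
a sum over atoms, and nonnegativity makes the order of summation irrelevant. -/

lemma energy_add (S T : H →L[ℂ] H) (x : H) : energy (S + T) x = energy S x + energy T x := by
  simp [energy]

lemma energy_sum {ι : Type*} (s : Finset ι) (T : ι → H →L[ℂ] H) (x : H) :
    energy (∑ i ∈ s, T i) x = ∑ i ∈ s, energy (T i) x := by
  simp [energy]

lemma energy_nonneg {T : H →L[ℂ] H} (hT : 0 ≤ T) (x : H) : 0 ≤ energy T x :=
  ((ContinuousLinearMap.nonneg_iff_isPositive T).1 hT).re_inner_nonneg_right x

end Energy

/-! ### Square roots, the splitting of a residual, and leakage at every node. -/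

section Operators

variable {H : Type*} [NormedAddCommGroup H] [InnerProductSpace ℂ H] [CompleteSpace H]

lemma sqrt_isPositive (T : H →L[ℂ] H) : (CFC.sqrt T).IsPositive :=
  (ContinuousLinearMap.nonneg_iff_isPositive _).1 (CFC.sqrt_nonneg T)

lemma inner_sqrt_left (T : H →L[ℂ] H) (x y : H) :
    inner ℂ (CFC.sqrt T x) y = inner ℂ x (CFC.sqrt T y) :=
  (sqrt_isPositive T).isSymmetric x y

lemma sqrt_sqrt_apply {T : H →L[ℂ] H} (hT : 0 ≤ T) (x : H) :
    CFC.sqrt T (CFC.sqrt T x) = T x := by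
  rw [← mul_apply_eq_comp, CFC.sqrt_mul_sqrt_self T hT]

lemma energy_eq_norm_sqrt_sq {T : H →L[ℂ] H} (hT : 0 ≤ T) (x : H) :
    energy T x = ‖CFC.sqrt T x‖ ^ 2 := by
  rw [energy, ← sqrt_sqrt_apply hT, ← inner_sqrt_left, inner_self_eq_norm_sq_to_K]
  norm_cast

lemma sqrt_apply_eq_zero_of_energy_eq_zero {T : H →L[ℂ] H} (hT : 0 ≤ T) {x : H}
    (h : energy T x = 0) : CFC.sqrt T x = 0 := by
  rw [energy_eq_norm_sqrt_sq hT] at h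
  simpa using h

lemma energy_dissipation (P R : H →L[ℂ] H) (x : H) :
    energy (dissipation P R) x = energy P (CFC.sqrt R x) := by
  simp [energy, dissipation, inner_sqrt_left]

lemma dissipation_nonneg {P : H →L[ℂ] H} (hP : IsStarProjection P) (R : H →L[ℂ] H) :
    0 ≤ dissipation P R :=
  (sqrt_isPositive R).isSelfAdjoint.conjugate_nonneg hP.nonneg

lemma residualMap_nonneg {P : H →L[ℂ] H} (hP : IsStarProjection P) (R : H →L[ℂ] H) :
    0 ≤ residualMap P R :=
  (sqrt_isPositive R).isSelfAdjoint.conjugate_nonneg hP.one_sub.nonneg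

lemma residualMap_add_dissipation (P : H →L[ℂ] H) {R : H →L[ℂ] H} (hR : 0 ≤ R) :
    residualMap P R + dissipation P R = R := by
  rw [residualMap, dissipation, ← add_mul, ← mul_add, sub_add_cancel, mul_one,
    CFC.sqrt_mul_sqrt_self R hR]

variable {m : ℕ}

lemma residual_concat (P : Fin m → H →L[ℂ] H) (R₀ : H →L[ℂ] H) (w : List (Fin m)) (j : Fin m) :
    residual P R₀ (w ++ [j]) = residualMap (P j) (residual P R₀ w) := by
  simp [residual]

lemma residual_nonneg {P : Fin m → H →L[ℂ] H} (hP : ∀ j, IsStarProjection (P j))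
    {R₀ : H →L[ℂ] H} (hR₀ : 0 ≤ R₀) (w : List (Fin m)) : 0 ≤ residual P R₀ w := by
  induction w using List.reverseRecOn with
  | nil => exact hR₀
  | append_singleton w j _ => rw [residual_concat]; exact residualMap_nonneg (hP j) _

lemma energy_residual_concat_add {P : Fin m → H →L[ℂ] H} (hP : ∀ j, IsStarProjection (P j))
    {R₀ : H →L[ℂ] H} (hR₀ : 0 ≤ R₀) (w : List (Fin m)) (j : Fin m) (x : H) :
    energy (residual P R₀ (w ++ [j])) x + energy (dissipated P R₀ w j) x =
      energy (residual P R₀ w) x := by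
  rw [residual_concat, dissipated, ← energy_add,
    residualMap_add_dissipation _ (residual_nonneg hP hR₀ w)]

lemma energy_dissipated_nonneg {P : Fin m → H →L[ℂ] H} (hP : ∀ j, IsStarProjection (P j))
    (R₀ : H →L[ℂ] H) (w : List (Fin m)) (j : Fin m) (x : H) :
    0 ≤ energy (dissipated P R₀ w j) x :=
  energy_dissipation_nonneg (hP j) _ x

lemma energy_dissipated_le {P : Fin m → H →L[ℂ] H} (hP : ∀ j, IsStarProjection (P j))
    {R₀ : H →L[ℂ] H} (hR₀ : 0 ≤ R₀) (w : List (Fin m)) (j : Fin m) (x : H) :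
    energy (dissipated P R₀ w j) x ≤ energy (residual P R₀ w) x := by
  linarith [energy_residual_concat_add hP hR₀ w j x,
    energy_nonneg (residual_nonneg hP hR₀ (w ++ [j])) x]

lemma energy_residual_le {P : Fin m → H →L[ℂ] H} (hP : ∀ j, IsStarProjection (P j))
    {R₀ : H →L[ℂ] H} (hR₀ : 0 ≤ R₀) (w : List (Fin m)) (x : H) :
    energy (residual P R₀ w) x ≤ energy R₀ x := by
  induction w using List.reverseRecOn with
  | nil => exact le_rfl
  | append_singleton w j ih =>
    linarith [energy_residual_concat_add hP hR₀ w j x, energy_dissipated_nonneg hP R₀ w j x]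

/-- By duality: a vector orthogonal to the range of `R₀^{1/2}` is killed by `R₀^{1/2}`, so it has
zero `R₀`-energy, hence zero `R`-energy, and is killed by `R^{1/2}` as well. -/
lemma sqrt_apply_mem_support {R R₀ : H →L[ℂ] H} (hR : 0 ≤ R) (hR₀ : 0 ≤ R₀)
    (hle : ∀ y, energy R y ≤ energy R₀ y) (v : H) : CFC.sqrt R v ∈ support R₀ := by
  rw [support, ← Submodule.orthogonal_orthogonal_eq_closure, Submodule.mem_orthogonal]
  intro y hy
  have h0 : CFC.sqrt R₀ y = 0 := by
    have h : inner ℂ (CFC.sqrt R₀ (CFC.sqrt R₀ y)) y = 0 :=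
      (Submodule.mem_orthogonal _ y).1 hy _ ⟨CFC.sqrt R₀ y, rfl⟩
    rwa [inner_sqrt_left, inner_self_eq_zero] at h
  have h1 : energy R y = 0 :=
    le_antisymm ((hle y).trans_eq (by simp [energy_eq_norm_sqrt_sq hR₀, h0])) (energy_nonneg hR y)
  rw [← inner_sqrt_left, sqrt_apply_eq_zero_of_energy_eq_zero hR h1, inner_zero_left]

/-- This is leakage tested on `v = R_w^{1/2} x`, whose squared norm is the residual energy at `w`.
-/
lemma mul_energy_residual_le_sum {P : Fin m → H →L[ℂ] H} (hP : ∀ j, IsStarProjection (P j))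
    {R₀ : H →L[ℂ] H} (hR₀ : 0 ≤ R₀) {α : ℝ}
    (hα : ∀ v ∈ support R₀, α * ‖v‖ ^ 2 ≤ energy (∑ j, P j) v) (w : List (Fin m)) (x : H) :
    α * energy (residual P R₀ w) x ≤ ∑ j, energy (dissipated P R₀ w j) x := by
  have hw := residual_nonneg hP hR₀ w
  have := hα _ (sqrt_apply_mem_support hw hR₀ (energy_residual_le hP hR₀ w) x)
  rw [← energy_eq_norm_sqrt_sq hw, energy_sum] at this
  simpa only [dissipated, energy_dissipation] using this

end Operators

/-! ### Parseval's identity and its tails. -/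

section Parseval

variable {H : Type*} [NormedAddCommGroup H] [InnerProductSpace ℂ H]

lemma _root_.HilbertBasis.hasSum_norm_inner_sq {ι : Type*} (b : HilbertBasis ι ℂ H) (x : H) :
    HasSum (fun i => ‖inner ℂ (b i) x‖ ^ 2) (‖x‖ ^ 2) := by
  have h := Complex.hasSum_re (b.hasSum_inner_mul_inner x x)
  convert h using 1
  · ext i
    rw [← inner_conj_symm (b i) x, Complex.mul_conj, Complex.ofReal_re, Complex.normSq_eq_norm_sq,
      Complex.norm_conj]
  · rw [inner_self_eq_norm_sq_to_K]; norm_cast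

/-- Parseval for the remainder, whose coefficients vanish on `F`. The majorant `c` is what later
makes the tail bound uniform in `z`. -/
lemma _root_.HilbertBasis.norm_sub_sum_sq_le {ι : Type*} [DecidableEq ι] (b : HilbertBasis ι ℂ H)
    (F : Finset ι) (z : H) {c : ι → ℝ} (hc : Summable c)
    (h : ∀ i, ‖inner ℂ (b i) z‖ ^ 2 ≤ c i) :
    ‖z - ∑ i ∈ F, (inner ℂ (b i) z : ℂ) • b i‖ ^ 2 ≤ ∑' i, c i - ∑ i ∈ F, c i := by
  have hcoef (j : ι) : (inner ℂ (b j) (z - ∑ i ∈ F, (inner ℂ (b i) z : ℂ) • b i) : ℂ) =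
      if j ∈ F then 0 else inner ℂ (b j) z := by
    rw [inner_sub_right, inner_sum]
    simp only [inner_smul_right, orthonormal_iff_ite.1 b.orthonormal]
    by_cases hj : j ∈ F <;> simp [hj]
  have h1 := b.hasSum_norm_inner_sq (z - ∑ i ∈ F, (inner ℂ (b i) z : ℂ) • b i)
  have h2 : HasSum (fun j => if j ∈ F then c j else 0) (∑ i ∈ F, c i) := by
    have := hasSum_sum_of_ne_finset_zero (L := SummationFilter.unconditional ι)
      (f := fun j => if j ∈ F then c j else 0) (s := F)
      (by intro j hj; simp [hj])
    rwa [Finset.sum_congr rfl (g := c) (fun j hj => by simp [hj])] at this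
  refine hasSum_le (fun j => ?_) h1 (hc.hasSum.sub h2)
  rw [hcoef]
  by_cases hj : j ∈ F
  · simp [hj]
  · simpa [hj] using h j

end Parseval

/-! ### Countable spectral decompositions from a summable diagonal. -/

section Spectral

variable {H : Type u} [NormedAddCommGroup H] [InnerProductSpace ℂ H] [CompleteSpace H]

/-- A positive operator whose diagonal in some Hilbert basis is summable is compact. -/
lemma isCompactOperator_of_summable_energy {ι : Type*} (b : HilbertBasis ι ℂ H) {T : H →L[ℂ] H}
    (hT : 0 ≤ T) (hs : Summable fun i => energy T (b i)) : IsCompactOperator T := by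
  classical
  set S := CFC.sqrt T with hS
  -- The finite-rank truncation of `S`: the projection onto the span of `b i`, `i ∈ F`, composed
  -- with `S`.
  let A (F : Finset ι) : H →L[ℂ] H :=
    ∑ i ∈ F, (innerSL ℂ (S (b i))).smulRight (b i)
  have hA (F : Finset ι) : IsCompactOperator (A F) := by
    refine (compactOperator (RingHom.id ℂ) H H).sum_mem (t := F) fun i _ => ?_
    have h : IsCompactOperator (innerSL ℂ (S (b i)) : H →L[ℂ] ℂ) :=
      isCompactOperator_of_locallyCompactSpace_dom _
    exact h.clm_comp (ContinuousLinearMap.toSpanSingleton ℂ (b i))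
  have hb (F : Finset ι) : ‖A F - S‖ ≤
      Real.sqrt (∑' i, energy T (b i) - ∑ i ∈ F, energy T (b i)) := by
    refine ContinuousLinearMap.opNorm_le_bound _ (Real.sqrt_nonneg _) fun y => ?_
    -- Moving `S` onto `b i` bounds each coefficient by `‖S (b i)‖ ‖y‖`, which gives a
    -- Hilbert–Schmidt tail bound on the operator norm.
    have hi (i : ι) : ‖(inner ℂ (b i) (S y) : ℂ)‖ ^ 2 ≤ energy T (b i) * ‖y‖ ^ 2 := by
      rw [hS, ← inner_sqrt_left, energy_eq_norm_sqrt_sq hT, ← mul_pow]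
      gcongr
      exact norm_inner_le_norm _ _
    have h := b.norm_sub_sum_sq_le F (S y) (hs.mul_right (‖y‖ ^ 2)) hi
    rw [tsum_mul_right, ← Finset.sum_mul, ← sub_mul] at h
    have e : (A F - S) y = -(S y - ∑ i ∈ F, (inner ℂ (b i) (S y) : ℂ) • b i) := by
      simp only [A, sub_apply, sum_apply,
        ContinuousLinearMap.smulRight_apply, innerSL_apply_apply, neg_sub]
      simp only [hS, inner_sqrt_left]
    rw [e, norm_neg]
    have h' := Real.sqrt_le_sqrt h
    rwa [Real.sqrt_sq (norm_nonneg _), Real.sqrt_mul' _ (sq_nonneg _),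
      Real.sqrt_sq (norm_nonneg _)] at h'
  have hlim : Tendsto A atTop (𝓝 S) := by
    rw [tendsto_iff_norm_sub_tendsto_zero]
    refine squeeze_zero (fun _ => norm_nonneg _) hb ?_
    have : Tendsto (fun F : Finset ι => ∑' i, energy T (b i) - ∑ i ∈ F, energy T (b i)) atTop
        (𝓝 0) := by
      simpa using (tendsto_const_nhds (x := ∑' i, energy T (b i))).sub hs.hasSum
    simpa using this.sqrt
  have hSc : IsCompactOperator S := isCompactOperator_of_tendsto hlim (Eventually.of_forall hA)
  have hST : (S * S : H →L[ℂ] H) = T := CFC.sqrt_mul_sqrt_self T hT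
  rw [← hST]
  exact hSc.clm_comp S

/-- A compact positive operator has a Hilbert basis of eigenvectors. -/
lemma exists_hilbertBasis_eigenvectors {T : H →L[ℂ] H} (hT : 0 ≤ T) (hc : IsCompactOperator T) :
    ∃ (κ : Type u) (B : HilbertBasis κ ℂ H) (ev : κ → ℝ),
      (∀ r, 0 ≤ ev r) ∧ ∀ r, T (B r) = (ev r : ℂ) • B r := by
  have hpos := (ContinuousLinearMap.nonneg_iff_isPositive T).1 hT
  have hsym : (T : H →ₗ[ℂ] H).IsSymmetric := hpos.isSymmetric
  let V (μ : ℂ) : Submodule ℂ H := Module.End.eigenspace (T : Module.End ℂ H) μ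
  have hVcl (μ : ℂ) : IsClosed (V μ : Set H) := by
    have : (V μ : Set H) = {v | T v = μ • v} := by
      ext v; exact Module.End.mem_eigenspace_iff
    rw [this]
    exact isClosed_eq T.continuous (continuous_const_smul μ)
  have hVc (μ : ℂ) : CompleteSpace (V μ) := (hVcl μ).completeSpace_coe
  -- Bases of all eigenspaces, the kernel `μ = 0` included, are glued into one orthonormal family.
  choose w b hb using fun μ : ℂ => exists_hilbertBasis ℂ (V μ)
  let v : (Σ μ : ℂ, w μ) → H := fun r => (b r.1 r.2 : H)
  have hv : Orthonormal ℂ v :=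
    hsym.orthogonalFamily_eigenspaces.orthonormal_sigma_orthonormal
      (v_family := fun μ i => b μ i) fun μ => (b μ).orthonormal
  have hTv (r) : T (v r) = r.1 • v r := Module.End.mem_eigenspace_iff.1 (b r.1 r.2).2
  have hperp : (Submodule.span ℂ (Set.range v))ᗮ = ⊥ := by
    rw [eq_bot_iff,
      ← ContinuousLinearMap.orthogonalComplement_iSup_eigenspaces_eq_bot hc hsym]
    intro y hy
    -- A vector orthogonal to every basis vector is orthogonal to each eigenspace, by expanding in
    -- its basis; the spectral theorem for compact symmetric operators then forces it to be zero.
    have hle : (⨆ μ, V μ) ≤ (ℂ ∙ y)ᗮ := by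
      refine iSup_le fun μ e he => ?_
      rw [Submodule.mem_orthogonal_singleton_iff_inner_right]
      have h := ((b μ).hasSum_repr ⟨e, he⟩).mapL (innerSL ℂ y ∘L (V μ).subtypeL)
      refine h.unique ?_
      convert! hasSum_zero using 2 with i
      have : inner ℂ y (b μ i : H) = 0 :=
        (Submodule.mem_orthogonal' _ y).1 hy _ (Submodule.subset_span ⟨⟨μ, i⟩, rfl⟩)
      simp [this]
    rw [Submodule.mem_orthogonal]
    exact fun u hu => Submodule.mem_orthogonal_singleton_iff_inner_left.1 (hle hu)
  have hnn (r : Σ μ : ℂ, w μ) : 0 ≤ r.1 := by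
    have h := hpos.inner_nonneg_right (v r)
    rw [hTv, inner_smul_right, inner_self_eq_norm_sq_to_K, hv.1 r] at h
    simpa using h
  have hre (r : Σ μ : ℂ, w μ) : (r.1.re : ℂ) = r.1 :=
    Complex.ext (by simp) (by simpa using (Complex.le_def.1 (hnn r)).2)
  refine ⟨_, HilbertBasis.mkOfOrthogonalEqBot hv hperp, fun r => r.1.re,
    fun r => (Complex.le_def.1 (hnn r)).1, fun r => ?_⟩
  rw [HilbertBasis.coe_mkOfOrthogonalEqBot, hre, hTv]

/-- A positive operator whose diagonal in some Hilbert basis is summable has a countable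
spectral decomposition. -/
lemma exists_spectralSystem {ι : Type*} (b : HilbertBasis ι ℂ H) {T : H →L[ℂ] H}
    (hT : 0 ≤ T) (hs : Summable fun i => energy T (b i)) :
    ∃ κ : Type, Countable κ ∧ Nonempty (SpectralSystem T κ) := by
  obtain ⟨κ, B, ev, hev, hB⟩ :=
    exists_hilbertBasis_eigenvectors hT (isCompactOperator_of_summable_energy b hT hs)
  have hsym : ∀ y z, inner ℂ (T y) z = inner ℂ y (T z) :=
    ((ContinuousLinearMap.nonneg_iff_isPositive T).1 hT).isSymmetric
  have hTb (i : ι) (hi : energy T (b i) = 0) : T (b i) = 0 := by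
    rw [← sqrt_sqrt_apply hT, sqrt_apply_eq_zero_of_energy_eq_zero hT hi, map_zero]
  let J : Set κ := {r | ev r ≠ 0}
  have hJ : J.Countable := by
    -- `H` need not be separable. An eigenvector with nonzero eigenvalue must pair nontrivially with
    -- some `T (b i)` of nonzero energy; there are countably many such `i`, and by Parseval each
    -- pairs with countably many eigenvectors.
    have hsub : J ⊆ ⋃ i ∈ Function.support (fun i => energy T (b i)),
        Function.support (fun r => ‖inner ℂ (B r) (T (b i))‖ ^ 2) := by
      intro r hr
      by_contra hcon
      simp only [Set.mem_iUnion, Function.mem_support, not_exists, not_not] at hcon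
      have h0 (i : ι) : inner ℂ (b i) (T (B r)) = 0 := by
        rw [← hsym, ← inner_conj_symm, map_eq_zero]
        by_cases hi : energy T (b i) = 0
        · rw [hTb i hi, inner_zero_right]
        · simpa using hcon i hi
      have h1 : T (B r) = 0 := by
        have h := b.hasSum_norm_inner_sq (T (B r))
        simp only [h0, norm_zero, ne_eq, OfNat.ofNat_ne_zero, not_false_eq_true, zero_pow] at h
        simpa using h.unique hasSum_zero
      rw [hB, smul_eq_zero] at h1
      rcases h1 with h1 | h1
      · exact hr (by exact_mod_cast h1)
      · exact B.orthonormal.ne_zero r h1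
    exact (hs.countable_support.biUnion fun i _ =>
      (B.hasSum_norm_inner_sq (T (b i))).summable.countable_support).mono hsub
  have : Countable J := hJ
  -- Reindexing by a subset of `ℕ` brings the index set from universe `u` down to `Type`.
  obtain ⟨f, hf⟩ := exists_injective_nat J
  let e : Set.range f ≃ J := (Equiv.ofInjective f hf).symm
  refine ⟨Set.range f, inferInstance, ⟨fun n => B (e n), fun n => ev (e n),
    B.orthonormal.comp _ (Subtype.val_injective.comp e.injective), fun n => hev _, fun y => ?_⟩⟩
  have hy := (B.hasSum_repr y).mapL T
  have hterm (r : κ) : T (B.repr y r • B r) = ((ev r : ℂ) * inner ℂ (B r) y) • B r := by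
    rw [map_smul, hB, HilbertBasis.repr_apply_apply, smul_smul, mul_comm]
  simp only [hterm] at hy
  -- Zero eigenvalues contribute nothing to the expansion of `T y`.
  have hJy := (hasSum_subtype_iff_of_support_subset (s := J) (by
    intro r hr h
    exact hr (by simp [h]))).2 hy
  exact e.hasSum_iff.2 hJy

end Spectral

/-! ### Energy as a sum over atoms. -/

section Atoms

variable {H : Type*} [NormedAddCommGroup H] [InnerProductSpace ℂ H]

/-- Pair the strong expansion of `T x` with `x`: each term becomes `λᵣ |⟨uᵣ, x⟩|²`. No countability
of the index set enters. -/
lemma SpectralSystem.hasSum_norm_inner_atom_sq {T : H →L[ℂ] H} {ι : Type*}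
    (S : SpectralSystem T ι) (x : H) :
    HasSum (fun r => ‖inner ℂ x (S.atom r)‖ ^ 2) (energy T x) := by
  have h := Complex.hasSum_re ((S.hasSum x).mapL (innerSL ℂ x))
  convert! h using 2 with r
  rw [innerSL_apply_apply, inner_smul_right, mul_assoc, ← inner_conj_symm (S.u r) x,
    Complex.conj_mul', SpectralSystem.atom, inner_smul_right, norm_mul, mul_pow,
    Complex.norm_real, Real.norm_of_nonneg (Real.sqrt_nonneg _), Real.sq_sqrt (S.ev_nonneg r)]
  norm_cast

end Atoms

/-! ### Expected contraction, almost sure decay, and telescoping. -/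

section Branching

variable {H : Type*} [NormedAddCommGroup H] [InnerProductSpace ℂ H] [CompleteSpace H] {m : ℕ}

lemma pre_succ (ω : ℕ → Fin m) (n : ℕ) : pre ω (n + 1) = pre ω n ++ [ω n] := by
  rw [pre, List.ofFn_succ_last]
  rfl

lemma measurable_comp_pre {β : Type*} [MeasurableSpace β] (g : List (Fin m) → β) (n : ℕ) :
    Measurable fun ω : ℕ → Fin m => g (pre ω n) :=
  (measurable_of_finite fun w : Fin n → Fin m => g (List.ofFn w)).comp
    (measurable_pi_lambda (fun (ω : ℕ → Fin m) (i : Fin n) => ω i) fun i =>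
      measurable_pi_apply (i : ℕ))

lemma lintegral_pre (μ : Measure (ℕ → Fin m)) (g : List (Fin m) → ENNReal) (n : ℕ) :
    ∫⁻ ω, g (pre ω n) ∂μ =
      ∑ w : Fin n → Fin m, g (List.ofFn w) * μ {ω | ∀ i : Fin n, ω i = w i} := by
  have hπ : Measurable fun (ω : ℕ → Fin m) (i : Fin n) => ω i :=
    measurable_pi_lambda _ fun i => measurable_pi_apply (i : ℕ)
  have h := lintegral_map (μ := μ) (measurable_of_finite fun w : Fin n → Fin m => g (List.ofFn w)) hπ
  rw [lintegral_fintype] at h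
  refine h.symm.trans (Finset.sum_congr rfl fun w _ => ?_)
  rw [Measure.map_apply hπ (measurableSet_singleton w)]
  congr 2
  ext ω
  simp [funext_iff]

lemma pathMeasure_cylinder_snoc (P : Fin m → H →L[ℂ] H) (hP : ∀ j, IsStarProjection (P j))
    (R₀ : H →L[ℂ] H) (x : H) (q : stdSimplex ℝ (Fin m)) {n : ℕ} (w : Fin n → Fin m) (j : Fin m) :
    pathMeasure P hP R₀ x q
        {ω | ∀ i : Fin (n + 1), ω i = (Fin.snoc w j : Fin (n + 1) → Fin m) i} =
      pathMeasure P hP R₀ x q {ω | ∀ i : Fin n, ω i = w i} *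
        ENNReal.ofReal (transProb P R₀ x q (List.ofFn w) j) := by
  -- The cylinder formula speaks of an infinite branch, so `w` is continued by `j`; entries beyond
  -- position `n` are immaterial.
  let η : ℕ → Fin m := fun k => if h : k < n then w ⟨k, h⟩ else j
  have hw (i : Fin n) : η i = w i := by simp [η]
  have hj : η n = j := by simp [η]
  have h1 : {ω : ℕ → Fin m | ∀ i : Fin n, ω i = w i} = {ω | ∀ i < n, ω i = η i} := by
    ext ω
    exact ⟨fun h i hi => (h ⟨i, hi⟩).trans (hw ⟨i, hi⟩).symm,
      fun h i => (h i i.2).trans (hw i)⟩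
  have h2 : {ω : ℕ → Fin m | ∀ i : Fin (n + 1), ω i = (Fin.snoc w j : Fin (n + 1) → Fin m) i} =
      {ω | ∀ i < n + 1, ω i = η i} := by
    ext ω
    simp only [Set.mem_ofPred_eq, Fin.forall_fin_succ', Fin.snoc_castSucc, Fin.snoc_last,
      Fin.val_castSucc, Fin.val_last, Nat.forall_lt_succ_right, hj, ← hw]
    exact and_congr_left fun _ => ⟨fun h i hi => h ⟨i, hi⟩, fun h i => h i i.2⟩
  have hpre : pre η n = List.ofFn w := by simp only [pre, hw]
  rw [h1, h2, pathMeasure_cylinder, pathMeasure_cylinder, Finset.prod_range_succ, hpre, hj]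

/-- One step of the energy-biased branching contracts the expected residual energy. -/
lemma sum_transProb_mul_energy_le {P : Fin m → H →L[ℂ] H} (hP : ∀ j, IsStarProjection (P j))
    {R₀ : H →L[ℂ] H} (hR₀ : 0 ≤ R₀) {α : ℝ} (hα₀ : 0 < α)
    (hα : ∀ v ∈ support R₀, α * ‖v‖ ^ 2 ≤ energy (∑ j, P j) v)
    (q : stdSimplex ℝ (Fin m)) (w : List (Fin m)) (x : H) :
    ∑ j, energy (residual P R₀ (w ++ [j])) x * transProb P R₀ x q w j ≤
      (1 - α / m) * energy (residual P R₀ w) x := by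
  set s := energy (residual P R₀ w) x
  set a : Fin m → ℝ := fun j => energy (dissipated P R₀ w j) x
  have hs0 : 0 ≤ s := energy_nonneg (residual_nonneg hP hR₀ w) x
  have ha0 (j) : 0 ≤ a j := energy_dissipated_nonneg hP R₀ w j x
  have hS : α * s ≤ ∑ j, a j := mul_energy_residual_le_sum hP hR₀ hα w x
  have hstep (j) : energy (residual P R₀ (w ++ [j])) x = s - a j := by
    linarith [energy_residual_concat_add hP hR₀ w j x]
  have hsum : ∑ j, energy (residual P R₀ (w ++ [j])) x * transProb P R₀ x q w j =
      s - ∑ j, a j * transProb P R₀ x q w j := by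
    simp only [hstep, sub_mul, Finset.sum_sub_distrib, ← Finset.mul_sum, sum_transProb, mul_one]
  -- The expected one-step loss must be at least the fraction `α / m` of `s`.
  suffices h : α / m * s ≤ ∑ j, a j * transProb P R₀ x q w j by linarith
  by_cases hpos : 0 < ∑ j, a j
  · have hm : (0 : ℝ) < m := by
      rcases Nat.eq_zero_or_pos m with rfl | hm
      · simp at hpos
      · exact_mod_cast hm
    have hterm (j) : a j * transProb P R₀ x q w j = a j ^ 2 / ∑ k, a k := by
      rw [transProb, if_pos hpos]; ring
    have hcs : (∑ j, a j) ^ 2 ≤ m * ∑ j, a j ^ 2 := by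
      simpa using sq_sum_le_card_mul_sum_sq (s := Finset.univ) (f := a)
    simp only [hterm, ← Finset.sum_div]
    rw [div_mul_eq_mul_div, div_le_div_iff₀ hm hpos]
    nlinarith
  -- At a dead node leakage forces `s = 0`, so the reference law `q` has no influence.
  · have hs' : s = 0 := by nlinarith
    rw [hs', mul_zero]
    exact Finset.sum_nonneg fun j _ => mul_nonneg (ha0 j) (transProb_nonneg hP R₀ x q w j)

/-- Induction on `n`: splitting off the last letter of a word turns the integral into an average
over prefixes of the one-step expectation. -/
lemma lintegral_energy_residual_le {P : Fin m → H →L[ℂ] H} (hP : ∀ j, IsStarProjection (P j))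
    {R₀ : H →L[ℂ] H} (hR₀ : 0 ≤ R₀) {α : ℝ} (hα₀ : 0 < α)
    (hα : ∀ v ∈ support R₀, α * ‖v‖ ^ 2 ≤ energy (∑ j, P j) v)
    (q : stdSimplex ℝ (Fin m)) (x : H) (n : ℕ) :
    ∫⁻ ω, ENNReal.ofReal (energy (residual P R₀ (pre ω n)) x) ∂pathMeasure P hP R₀ x q ≤
      ENNReal.ofReal (1 - α / m) ^ n * ENNReal.ofReal (energy R₀ x) := by
  induction n with
  | zero => simp [pre, residual]
  | succ n ih =>
    rw [pow_succ', mul_assoc]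
    refine le_trans ?_ (mul_le_mul_right ih _)
    rw [lintegral_pre _ (fun w => ENNReal.ofReal (energy (residual P R₀ w) x)),
      lintegral_pre _ (fun w => ENNReal.ofReal (energy (residual P R₀ w) x)),
      ← (Fin.snocEquiv fun _ => Fin m).sum_comp, Fintype.sum_prod_type_right, Finset.mul_sum]
    refine Finset.sum_le_sum fun w _ => ?_
    have hofFn (j : Fin m) : List.ofFn (Fin.snoc w j : Fin (n + 1) → Fin m) =
        List.ofFn w ++ [j] := by
      rw [List.ofFn_succ_last]
      simp only [Fin.snoc_castSucc, Fin.snoc_last]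
    simp only [Fin.snocEquiv, Equiv.coe_fn_mk, pathMeasure_cylinder_snoc, hofFn]
    simp only [mul_comm (pathMeasure P hP R₀ x q _), ← mul_assoc]
    rw [← Finset.sum_mul]
    gcongr
    -- Only the energy factor has to be nonnegative here, so the sign of `1 - α / m` does not
    -- matter.
    rw [← ENNReal.ofReal_mul' (energy_nonneg (residual_nonneg hP hR₀ _) x)]
    refine le_trans (le_of_eq ?_) (ENNReal.ofReal_le_ofReal
      (sum_transProb_mul_energy_le hP hR₀ hα₀ hα q (List.ofFn w) x))
    rw [ENNReal.ofReal_sum_of_nonneg fun j _ => mul_nonneg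
      (energy_nonneg (residual_nonneg hP hR₀ _) x) (transProb_nonneg hP R₀ x q _ j)]
    exact Finset.sum_congr rfl fun j _ =>
      (ENNReal.ofReal_mul (energy_nonneg (residual_nonneg hP hR₀ _) x)).symm

/-- Along almost every branch the residual energy tends to `0`. -/
lemma ae_tendsto_energy_residual (hm : 0 < m) {P : Fin m → H →L[ℂ] H}
    (hP : ∀ j, IsStarProjection (P j)) {R₀ : H →L[ℂ] H} (hR₀ : 0 ≤ R₀) (hleak : Leakage P R₀)
    (q : stdSimplex ℝ (Fin m)) (x : H) :
    ∀ᵐ ω ∂pathMeasure P hP R₀ x q,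
      Tendsto (fun n => energy (residual P R₀ (pre ω n)) x) atTop (𝓝 0) := by
  obtain ⟨α, hα₀, hα⟩ := hleak
  have hmeas (n : ℕ) : Measurable fun ω : ℕ → Fin m =>
      ENNReal.ofReal (energy (residual P R₀ (pre ω n)) x) :=
    measurable_comp_pre (fun w => ENNReal.ofReal (energy (residual P R₀ w) x)) n
  have hc : ENNReal.ofReal (1 - α / m) < 1 := by
    rw [ENNReal.ofReal_lt_one]
    have : 0 < α / m := by positivity
    linarith
  -- By Tonelli and the geometric series, the total residual energy along a branch has finite
  -- expectation.
  have hfin : ∫⁻ ω, ∑' n, ENNReal.ofReal (energy (residual P R₀ (pre ω n)) x)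
      ∂pathMeasure P hP R₀ x q ≠ ⊤ := by
    rw [lintegral_tsum fun n => (hmeas n).aemeasurable]
    refine ne_top_of_le_ne_top ?_
      (ENNReal.tsum_le_tsum (lintegral_energy_residual_le hP hR₀ hα₀ hα q x))
    rw [ENNReal.tsum_mul_right, ENNReal.tsum_geometric]
    exact ENNReal.mul_ne_top (ENNReal.inv_ne_top.2 (tsub_pos_of_lt hc).ne') ENNReal.ofReal_ne_top
  filter_upwards [ae_lt_top (Measurable.tsum hmeas) hfin] with ω hω
  have h := (ENNReal.tendsto_toReal ENNReal.zero_ne_top).comp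
    (ENNReal.tendsto_atTop_zero_of_tsum_ne_top hω.ne)
  simpa [Function.comp_def, ENNReal.toReal_ofReal,
    energy_nonneg (residual_nonneg hP hR₀ _) x] using h

lemma sum_branchEnergy {P : Fin m → H →L[ℂ] H} (hP : ∀ j, IsStarProjection (P j))
    {R₀ : H →L[ℂ] H} (hR₀ : 0 ≤ R₀) (x : H) (ω : ℕ → Fin m) (n : ℕ) :
    ∑ k ∈ Finset.range n, branchEnergy P R₀ x ω k =
      energy R₀ x - energy (residual P R₀ (pre ω n)) x := by
  induction n with
  | zero => simp [pre, residual]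
  | succ n ih =>
    rw [Finset.sum_range_succ, ih, pre_succ, branchEnergy, branchDissipated]
    linarith [energy_residual_concat_add hP hR₀ (pre ω n) (ω n) x]

lemma hasSum_branchEnergy {P : Fin m → H →L[ℂ] H} (hP : ∀ j, IsStarProjection (P j))
    {R₀ : H →L[ℂ] H} (hR₀ : 0 ≤ R₀) (x : H) {ω : ℕ → Fin m}
    (h : Tendsto (fun n => energy (residual P R₀ (pre ω n)) x) atTop (𝓝 0)) :
    HasSum (fun k => branchEnergy P R₀ x ω k) (energy R₀ x) := by
  have h0 (k) : 0 ≤ branchEnergy P R₀ x ω k := energy_dissipated_nonneg hP R₀ _ _ x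
  rw [hasSum_iff_tendsto_nat_of_nonneg h0]
  simp only [sum_branchEnergy hP hR₀]
  simpa using h.const_sub (energy R₀ x)

/-- Trace class passes down by domination: in the basis given for `R₀`, the diagonal of `Δ_k` is
bounded by that of `R₀`. -/
lemma exists_spectralSystem_branchDissipated {P : Fin m → H →L[ℂ] H}
    (hP : ∀ j, IsStarProjection (P j)) {R₀ : H →L[ℂ] H} (hR₀ : 0 ≤ R₀) (htr : IsTraceClass R₀)
    (ω : ℕ → Fin m) (k : ℕ) :
    ∃ ι : Type, Countable ι ∧ Nonempty (SpectralSystem (branchDissipated P R₀ ω k) ι) := by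
  obtain ⟨s, b, hb⟩ := htr
  rw [CFC.abs_of_nonneg R₀ hR₀] at hb
  refine exists_spectralSystem b (dissipation_nonneg (hP _) _)
    (hb.of_nonneg_of_le (fun i => energy_dissipated_nonneg hP R₀ _ _ _) fun i => ?_)
  exact (energy_dissipated_le hP hR₀ _ _ _).trans (energy_residual_le hP hR₀ _ _)

end Branching

end WR

theorem theorem6p2 {H : Type*} [NormedAddCommGroup H] [InnerProductSpace ℂ H] [CompleteSpace H]
    {m : ℕ} (hm : 2 ≤ m)
    (P : Fin m → H →L[ℂ] H) (hP : ∀ j, IsStarProjection (P j))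
    (R₀ : H →L[ℂ] H) (hR₀ : R₀.IsPositive) (htr : WR.IsTraceClass R₀)
    (hleak : WR.Leakage P R₀)
    (q : stdSimplex ℝ (Fin m))
    (x : H) (hx : 0 < WR.energy R₀ x) :
    (∀ (ω : ℕ → Fin m) (k : ℕ), ∃ ι : Type, Countable ι ∧
      Nonempty (WR.SpectralSystem (WR.branchDissipated P R₀ ω k) ι)) ∧
    ∃ Ωx : Set (ℕ → Fin m), MeasurableSet Ωx ∧ WR.pathMeasure P hP R₀ x q Ωx = 1 ∧
      ∀ ω ∈ Ωx,
        (∀ k, 0 ≤ WR.branchEnergy P R₀ x ω k) ∧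
        HasSum (fun k => WR.branchEnergy P R₀ x ω k) (WR.energy R₀ x) ∧
        ∀ (ι : ℕ → Type*) (S : ∀ k, WR.SpectralSystem (WR.branchDissipated P R₀ ω k) (ι k)),
          (∀ k, HasSum (fun r => ‖inner ℂ x ((S k).atom r)‖ ^ 2) (WR.branchEnergy P R₀ x ω k)) ∧
          HasSum (fun k => ∑' r, ‖inner ℂ x ((S k).atom r)‖ ^ 2) (WR.energy R₀ x) ∧
          HasSum (fun p : (k : ℕ) × ι k => ‖inner ℂ x ((S p.1).atom p.2)‖ ^ 2)
            (WR.energy R₀ x) := by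
  have hR : 0 ≤ R₀ := (ContinuousLinearMap.nonneg_iff_isPositive R₀).2 hR₀
  refine ⟨WR.exists_spectralSystem_branchDissipated hP hR htr,
    -- This set involves only the residual energies, so one null set serves all choices of spectral
    -- decompositions.
    {ω | Tendsto (fun n => WR.energy (WR.residual P R₀ (WR.pre ω n)) x) atTop (𝓝 0)},
    measurableSet_tendsto _ fun n =>
      WR.measurable_comp_pre (fun w => WR.energy (WR.residual P R₀ w) x) n,
    mem_ae_iff_prob_eq_one (measurableSet_tendsto _ fun n =>
      WR.measurable_comp_pre (fun w => WR.energy (WR.residual P R₀ w) x) n) |>.1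
      (WR.ae_tendsto_energy_residual (by omega) hP hR hleak q x),
    fun ω hω => ⟨fun k => WR.energy_dissipated_nonneg hP R₀ _ _ x,
      WR.hasSum_branchEnergy hP hR x hω, fun ι S => ?_⟩⟩
  have hatom (k : ℕ) : HasSum (fun r => ‖inner ℂ x ((S k).atom r)‖ ^ 2)
      (WR.branchEnergy P R₀ x ω k) := (S k).hasSum_norm_inner_atom_sq x
  have hiter : HasSum (fun k => ∑' r, ‖inner ℂ x ((S k).atom r)‖ ^ 2) (WR.energy R₀ x) := by
    simpa only [(hatom _).tsum_eq] using WR.hasSum_branchEnergy hP hR x hω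
  -- For nonnegative terms, summable fibres and a summable series of fibre sums give unconditional
  -- summability over pairs; the value is then that of the iterated sum.
  have hsum : Summable fun p : (k : ℕ) × ι k => ‖inner ℂ x ((S p.1).atom p.2)‖ ^ 2 :=
    (summable_sigma_of_nonneg fun _ => sq_nonneg _).2
      ⟨fun k => (hatom k).summable, hiter.summable⟩
  refine ⟨hatom, hiter, ?_⟩
  rw [← (hsum.hasSum.sigma fun k => (hsum.sigma_factor k).hasSum).unique hiter]
  exact hsum.hasSum
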